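/- Let $\mathbb{T}$ be the unit circle, let $\mu$ be a finite positive Borel measure on $\mathbb{T}$, and let $\mu^{c}$ be the measure $\mu^{c}(\Omega)=\mu(\{\bar\xi:\xi\in\Omega\})$. Assume $\mu^{c}\ll\mu$ and put $h=d\mu^{c}/d\mu$. Let $\mathcal{H}$ be a separable complex Hilbert space. A \emph{conjugation} on a Hilbert space is a map that is antilinear, isometric and involutive. Let $L^2(\mu,\mathcal{H})$ be the space of (classes of) $\mu$-measurable functions $f:\mathbb{T}\to\mathcal{H}$ with $\int\|f\|^2\,d\mu<\infty$, and let $M_\xi$ be the operator $(M_\xi f)(\xi)=\xi f(\xi)$ on it. Let $L^\infty(\mu,\mathcal{B}(\mathcal{H}))$ be the set of $\mu$-essentially bounded functions $F:\mathbb{T}\to\mathcal{B}(\mathcal{H})$ such that $\xi\mapsto F(\xi)x$ is $\mu$-measurable for every $x\in\mathcal{H}$. For such $F$ put $(M_Ff)(\xi)=F(\xi)f(\xi)$ and $F(\xi)^{\#}=F(\bar\xi)^{*}$. Fix a conjugation $J$ on $\mathcal{H}$ and define $J^{\#}$ on $L^2(\mu,\mathcal{H})$ by $$(J^{\#}f)(\xi)=h(\xi)^{1/2}\,J\big(f(\bar\xi)\big)\quad\text{for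 }\mu\text{-a.e. }\xi .$$ \textbf{Theorem.} For every closed subspace $\mathcal{K}$ of $L^2(\mu,\mathcal{H})$ the following are equivalent. (a) $C\mathcal{K}\subset\mathcal{K}$ for every conjugation $C$ on $L^2(\mu,\mathcal{H})$ with $CM_\xi C=M_\xi$. (b) $J^{\#}\mathcal{K}\subset\mathcal{K}$, and $M_F\mathcal{K}\subset\mathcal{K}$ for every $F\in L^\infty(\mu,\mathcal{B}(\mathcal{H}))$ with $JF(\xi)J=F(\xi)^{\#}$ for $\mu$-a.e. $\xi\in\mathbb{T}$. -/

import Mathlib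

open MeasureTheory Filter Topology

noncomputable section

/-- The Borel `σ`-algebra of the unit circle. -/
instance circleMeasurableSpace : MeasurableSpace Circle := borel Circle

instance circleBorelSpace : BorelSpace Circle := ⟨rfl⟩

/-- A conjugation: an antilinear, isometric, involutive map. -/
structure Conjugation (E : Type*) [NormedAddCommGroup E] [NormedSpace ℂ E] where
  toFun : E → E
  map_add' : ∀ x y, toFun (x + y) = toFun x + toFun y
  map_smul' : ∀ (a : ℂ) x, toFun (a • x) = (starRingEnd ℂ a) • toFun x
  norm_map' : ∀ x, ‖toFun x‖ = ‖x‖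
  involutive' : ∀ x, toFun (toFun x) = x

instance Conjugation.instCoeFun {E : Type*} [NormedAddCommGroup E] [NormedSpace ℂ E] :
    CoeFun (Conjugation E) (fun _ => E → E) := ⟨Conjugation.toFun⟩

theorem Conjugation.continuous {E : Type*} [NormedAddCommGroup E] [NormedSpace ℂ E]
    (C : Conjugation E) : Continuous (C : E → E) :=
  AddMonoidHomClass.continuous_of_bound (AddMonoidHom.mk' C.toFun C.map_add') 1
    (fun x => by simpa using (C.norm_map' x).le)

/-- The set of all conjugations `C` commuting with the operator `U`, that is, `C U C = U`. -/
def commutingConjugations {E : Type*} [NormedAddCommGroup E] [NormedSpace ℂ E]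
    (U : E →L[ℂ] E) : Set (Conjugation E) :=
  {C | ∀ x, C (U (C x)) = U x}

/-- Complex conjugation `ξ ↦ ξ̄` on the unit circle (there it agrees with inversion). -/
def circleConj (ξ : Circle) : Circle := ξ⁻¹

theorem coe_circleConj (ξ : Circle) : (circleConj ξ : ℂ) = starRingEnd ℂ (ξ : ℂ) :=
  Circle.coe_inv_eq_conj ξ

theorem measurable_circleConj : Measurable circleConj :=
  (continuous_inv : Continuous (fun ξ : Circle => ξ⁻¹)).measurable

/-- The reflected measure `μᶜ`, `μᶜ(Ω) = μ({ξ̄ : ξ ∈ Ω})`. -/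
def conjMeasure (μ : Measure Circle) : Measure Circle := μ.map circleConj

theorem conjMeasure_apply (μ : Measure Circle) {Ω : Set Circle} (hΩ : MeasurableSet Ω) :
    conjMeasure μ Ω = μ (circleConj '' Ω) := by
  have h : Function.Involutive circleConj := fun ξ => inv_inv ξ
  rw [conjMeasure, Measure.map_apply measurable_circleConj hΩ,
    Set.image_eq_preimage_of_inverse h.leftInverse h.rightInverse]

instance isFiniteMeasure_conjMeasure (μ : Measure Circle) [IsFiniteMeasure μ] :
    IsFiniteMeasure (conjMeasure μ) := by
  unfold conjMeasure; infer_instance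

section VectorValued

variable {H : Type*} [NormedAddCommGroup H] [InnerProductSpace ℂ H]

/-- `F` represents an element of `L^∞(μ, B(H))`: an essentially bounded operator-valued function
that is measurable in the usual operator sense (`ξ ↦ F ξ x` is `μ`-measurable for each `x`). -/
structure MemLinfty (F : Circle → H →L[ℂ] H) (μ : Measure Circle) : Prop where
  aestronglyMeasurable : ∀ x, AEStronglyMeasurable (fun ξ => F ξ x) μ
  ess_bounded : ∃ c : ℝ, ∀ᵐ ξ ∂μ, ‖F ξ‖ ≤ c

theorem MemLinfty.aestronglyMeasurable_apply {F : Circle → H →L[ℂ] H} {μ : Measure Circle}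
    (hF : MemLinfty F μ) {f : Circle → H} (hf : AEStronglyMeasurable f μ) :
    AEStronglyMeasurable (fun ξ => F ξ (f ξ)) μ := by
  have key : ∀ s : SimpleFunc Circle H, AEStronglyMeasurable (fun ξ => F ξ (s ξ)) μ := by
    intro s
    have h : (fun ξ => F ξ (s ξ))
        = fun ξ => ∑ y ∈ s.range, (s ⁻¹' {y}).indicator (fun ξ => F ξ y) ξ := by
      funext ξ
      rw [Finset.sum_eq_single (s ξ)]
      · simp
      · intro y _ hy
        exact Set.indicator_of_notMem (fun h => hy (by simpa using h.symm)) _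
      · intro h
        exact absurd (s.mem_range_self ξ) h
    rw [h]
    exact Finset.aestronglyMeasurable_fun_sum _ fun y _ =>
      (hF.aestronglyMeasurable y).indicator (s.measurableSet_fiber y)
  obtain ⟨g, hg, hfg⟩ := hf
  have h1 : AEStronglyMeasurable (fun ξ => F ξ (g ξ)) μ :=
    aestronglyMeasurable_of_tendsto_ae atTop (fun n => key (hg.approx n))
      (ae_of_all _ fun ξ => ((F ξ).continuous.tendsto _).comp (hg.tendsto_approx ξ))
  exact h1.congr (hfg.mono fun ξ h => by simp only [h])

theorem MemLinfty.memLp_apply {F : Circle → H →L[ℂ] H} {μ : Measure Circle}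
    (hF : MemLinfty F μ) (f : Lp H 2 μ) : MemLp (fun ξ => F ξ (f ξ)) 2 μ := by
  obtain ⟨c, hc⟩ := hF.ess_bounded
  refine (Lp.memLp f).of_le_mul (c := c)
    (hF.aestronglyMeasurable_apply (Lp.aestronglyMeasurable f)) ?_
  filter_upwards [hc] with ξ h
  exact ((F ξ).le_opNorm _).trans (mul_le_mul_of_nonneg_right h (norm_nonneg _))

/-- The multiplication operator `M_F` on `L²(μ, H)`: `(M_F f)(ξ) = F(ξ) f(ξ)`. -/
def mulOp {F : Circle → H →L[ℂ] H} {μ : Measure Circle} (hF : MemLinfty F μ) :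
    Lp H 2 μ →L[ℂ] Lp H 2 μ :=
  LinearMap.mkContinuousOfExistsBound
    { toFun := fun f => (hF.memLp_apply f).toLp _
      map_add' := fun f g => by
        rw [← MemLp.toLp_add, MemLp.toLp_eq_toLp_iff]
        filter_upwards [Lp.coeFn_add f g] with ξ h
        change F ξ ((f + g : Lp H 2 μ) ξ) = F ξ (f ξ) + F ξ (g ξ)
        rw [h, Pi.add_apply, map_add]
      map_smul' := fun a f => by
        rw [RingHom.id_apply, ← MemLp.toLp_const_smul, MemLp.toLp_eq_toLp_iff]
        filter_upwards [Lp.coeFn_smul a f] with ξ h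
        change F ξ ((a • f : Lp H 2 μ) ξ) = a • F ξ (f ξ)
        rw [h, Pi.smul_apply, map_smul] }
    (by
      obtain ⟨c, hc⟩ := hF.ess_bounded
      refine ⟨c, fun f => Lp.norm_le_mul_norm_of_ae_le_mul ?_⟩
      filter_upwards [hc, (hF.memLp_apply f).coeFn_toLp] with ξ h h'
      rw [LinearMap.coe_mk, AddHom.coe_mk, h']
      exact ((F ξ).le_opNorm _).trans (mul_le_mul_of_nonneg_right h (norm_nonneg _)))

theorem mulOp_ae {F : Circle → H →L[ℂ] H} {μ : Measure Circle} (hF : MemLinfty F μ)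
    (f : Lp H 2 μ) : ∀ᵐ ξ ∂μ, mulOp hF f ξ = F ξ (f ξ) :=
  (hF.memLp_apply f).coeFn_toLp

theorem memLinfty_coord (H : Type*) [NormedAddCommGroup H] [InnerProductSpace ℂ H]
    (μ : Measure Circle) :
    MemLinfty (fun ξ => (ξ : ℂ) • ContinuousLinearMap.id ℂ H) μ where
  aestronglyMeasurable x := by
    have h : Continuous (fun ξ : Circle => (ξ : ℂ)) := continuous_subtype_val
    exact (h.measurable.stronglyMeasurable.smul_const x).aestronglyMeasurable
  ess_bounded := ⟨1, ae_of_all _ fun ξ => by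
    rw [norm_smul, Circle.norm_coe, one_mul]
    exact ContinuousLinearMap.norm_id_le⟩

/-- The vector-valued bilateral shift `M_ξ` on `L²(μ, H)`: `(M_ξ f)(ξ) = ξ f(ξ)`. -/
def bilateralShift (H : Type*) [NormedAddCommGroup H] [InnerProductSpace ℂ H]
    (μ : Measure Circle) : Lp H 2 μ →L[ℂ] Lp H 2 μ :=
  mulOp (memLinfty_coord H μ)

/-- The operator-valued function `F^#`, `F^#(ξ) = F(ξ̄)^*`. -/
def sharp [CompleteSpace H] (F : Circle → H →L[ℂ] H) (ξ : Circle) : H →L[ℂ] H :=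
  ContinuousLinearMap.adjoint (F (circleConj ξ))

/-- The function `ξ ↦ h(ξ)^{1/2} J(f(ξ̄))`, where `h = dμᶜ/dμ`. -/
def jSharpFun (μ : Measure Circle) (J : Conjugation H) (f : Circle → H) (ξ : Circle) : H :=
  ((√((conjMeasure μ).rnDeriv μ ξ).toReal : ℝ) : ℂ) • J (f (circleConj ξ))

theorem memLp_jSharpFun {μ : Measure Circle} [IsFiniteMeasure μ] (hμ : conjMeasure μ ≪ μ)
    (J : Conjugation H) (f : Lp H 2 μ) : MemLp (jSharpFun μ J f) 2 μ := by
  have hm : AEStronglyMeasurable (fun ξ => J (f (circleConj ξ))) μ :=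
    J.continuous.comp_aestronglyMeasurable
      ((Lp.aestronglyMeasurable f).comp_quasiMeasurePreserving ⟨measurable_circleConj, hμ⟩)
  have hh : Measurable ((conjMeasure μ).rnDeriv μ) := Measure.measurable_rnDeriv _ _
  refine ⟨AEStronglyMeasurable.smul
    (Complex.measurable_ofReal.comp hh.ennreal_toReal.sqrt).aestronglyMeasurable hm, ?_⟩
  rw [eLpNorm_lt_top_iff_lintegral_rpow_enorm_lt_top (by simp) (by simp)]
  have hae : ∀ᵐ ξ ∂μ, ‖jSharpFun μ J f ξ‖ₑ ^ (2 : ENNReal).toReal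
      = (conjMeasure μ).rnDeriv μ ξ * ‖f (circleConj ξ)‖ₑ ^ (2 : ENNReal).toReal := by
    filter_upwards [Measure.rnDeriv_lt_top (conjMeasure μ) μ] with ξ hξ
    have hJ : ‖J (f (circleConj ξ))‖ₑ = ‖f (circleConj ξ)‖ₑ := by
      rw [← ofReal_norm, ← ofReal_norm, J.norm_map']
    rw [jSharpFun, enorm_smul, hJ, ENNReal.mul_rpow_of_nonneg _ _ (by simp)]
    congr 1
    rw [← ofReal_norm, Complex.norm_real, Real.norm_of_nonneg (Real.sqrt_nonneg _)]
    simp only [ENNReal.toReal_ofNat, ENNReal.rpow_ofNat]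
    rw [← ENNReal.ofReal_pow (Real.sqrt_nonneg _), Real.sq_sqrt ENNReal.toReal_nonneg,
      ENNReal.ofReal_toReal hξ.ne]
  have hmf : AEMeasurable (fun ξ => ‖f (circleConj ξ)‖ₑ ^ (2 : ENNReal).toReal) μ :=
    (((Lp.aestronglyMeasurable f).comp_quasiMeasurePreserving
      ⟨measurable_circleConj, hμ⟩).enorm).pow_const _
  have hinv : ∀ ξ, circleConj (circleConj ξ) = ξ := fun ξ => inv_inv ξ
  have hmm : Measure.map circleConj (conjMeasure μ) = μ := by
    rw [conjMeasure, Measure.map_map measurable_circleConj measurable_circleConj]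
    convert Measure.map_id
    exact funext hinv
  have hemb : MeasurableEmbedding circleConj :=
    (MeasurableEquiv.mk ⟨circleConj, circleConj, hinv, hinv⟩ measurable_circleConj
      measurable_circleConj).measurableEmbedding
  rw [lintegral_congr_ae hae, lintegral_rnDeriv_mul hμ hmf,
    ← hemb.lintegral_map (fun ξ => ‖f ξ‖ₑ ^ (2 : ENNReal).toReal), hmm]
  exact (eLpNorm_lt_top_iff_lintegral_rpow_enorm_lt_top (by simp) (by simp)).1 (Lp.memLp f).2

/-- The map `J^#` on `L²(μ, H)`: `(J^# f)(ξ) = h(ξ)^{1/2} J(f(ξ̄))`, where `h = dμᶜ/dμ`. -/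
def jSharp {μ : Measure Circle} [IsFiniteMeasure μ] (hμ : conjMeasure μ ≪ μ)
    (J : Conjugation H) (f : Lp H 2 μ) : Lp H 2 μ :=
  (memLp_jSharpFun hμ J f).toLp _

theorem jSharp_ae {μ : Measure Circle} [IsFiniteMeasure μ] (hμ : conjMeasure μ ≪ μ)
    (J : Conjugation H) (f : Lp H 2 μ) :
    ∀ᵐ ξ ∂μ, jSharp hμ J f ξ = jSharpFun μ J f ξ :=
  (memLp_jSharpFun hμ J f).coeFn_toLp

end VectorValued

end

/-! Write `V` for the shift. The map `J^#` is itself a conjugation with `J^# V J^# = V`, and a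
symbol with `J F J = F^#` gives an operator `T = M_F` commuting with `V` and satisfying `J^# T J^# =
T*`.

(a) ⇒ (b): `T` is a complex combination of skew-adjoint operators `X` that commute with `V` and
anticommute with `C = J^#`. Then `exp(tX) C` is again a conjugation commuting with `V` for every
real `t`. So `K` is invariant under `exp(tX) = (exp(tX) C) C`, and differentiating at `t = 0` gives
`X K ⊂ K` (`mem_of_skewAdjoint`, `mem_of_conj_eq_adjoint`).

(b) ⇒ (a): for any admissible `C`, the product `C J^#` is a linear isometry commuting with `V`,
hence a multiplication `M_F` by a field of isometries (`exists_mulOp_eq_of_commute`). The identity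
`C² = 1` becomes `F(ξ) J F(ξ̄) J = 1`, which forces `J F J = F^#` because `F(ξ)` is isometric. Thus
`C = M_F J^#` preserves `K` (`exists_mulOp_jSharp_eq`). -/

noncomputable section

section Conjugations

variable {E : Type*} [NormedAddCommGroup E] [NormedSpace ℂ E]

theorem Conjugation.map_sub (C : Conjugation E) (x y : E) : C (x - y) = C x - C y :=
  _root_.map_sub (AddMonoidHom.mk' C.toFun C.map_add') x y

theorem Conjugation.commutes_of_mem {C : Conjugation E} {V : E →L[ℂ] E}
    (hC : C ∈ commutingConjugations V) (x : E) : C (V x) = V (C x) := by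
  have h := hC (C x)
  rwa [C.involutive'] at h

end Conjugations

/-! ### Abstract conjugations, unitary groups and the commutant of an operator -/

section OperatorLevel

variable {E : Type*} [NormedAddCommGroup E] [InnerProductSpace ℂ E] [CompleteSpace E]

open NormedSpace in
/-- If the antilinear `C` anticommutes with `X`, then `C exp(X) = exp(-X) C`. -/
theorem Conjugation.exp_apply (C : Conjugation E) (X : E →L[ℂ] E)
    (hX : ∀ x, C (X x) = -X (C x)) (x : E) : C (exp X x) = exp (-X) (C x) := by
  have hpow : ∀ (n : ℕ) (y : E), C ((X ^ n) y) = ((-X) ^ n) (C y) := by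
    intro n
    induction n with
    | zero => intro y; simp
    | succ n ih =>
      intro y
      rw [pow_succ, pow_succ, mul_apply_eq_comp, mul_apply_eq_comp, ih, hX]
      rfl
  have h1 : HasSum (fun n : ℕ => C (((n.factorial : ℂ)⁻¹ • X ^ n) x)) (C (exp X x)) :=
    (((exp_series_hasSum_exp' (𝕂 := ℂ) X).mapL
      (ContinuousLinearMap.apply ℂ E x))).map (AddMonoidHom.mk' C.toFun C.map_add') C.continuous
  have h2 : HasSum (fun n : ℕ => ((n.factorial : ℂ)⁻¹ • (-X) ^ n) (C x)) (exp (-X) (C x)) :=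
    (exp_series_hasSum_exp' (𝕂 := ℂ) (-X)).mapL (ContinuousLinearMap.apply ℂ E (C x))
  refine h1.unique ?_
  convert h2 using 2 with n
  -- The coefficients `1/n!` are real, so antilinearity leaves them unchanged.
  rw [_root_.smul_apply, _root_.smul_apply, C.map_smul', hpow]
  simp

/-- A unitary `U` with `C U = U* C` composed with `C` is again a conjugation. -/
def Conjugation.unitaryComp (C : Conjugation E) (U : E →L[ℂ] E) (hU : U ∈ unitary (E →L[ℂ] E))
    (hCU : ∀ x, C (U x) = star U (C x)) : Conjugation E where
  toFun x := U (C x)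
  map_add' x y := by rw [C.map_add', map_add]
  map_smul' a x := by rw [C.map_smul', map_smul]
  norm_map' x := by
    rw [ContinuousLinearMap.norm_map_of_mem_unitary hU, C.norm_map']
  involutive' x := by
    rw [hCU, C.involutive', ← mul_apply_eq_comp, Unitary.mul_star_self_of_mem hU]
    rfl

-- Each `exp(tX)` with `t` real is a product of two conjugations commuting with `V`, so it preserves
-- `K`; its derivative at `0` is `X`, and `K` is closed.
open NormedSpace in
theorem mem_of_skewAdjoint {V : E →L[ℂ] E} {C : Conjugation E}
    (hC : C ∈ commutingConjugations V) {K : Submodule ℂ E} (hK : IsClosed (K : Set E))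
    (hinv : ∀ C ∈ commutingConjugations V, ∀ f ∈ K, C f ∈ K)
    {X : E →L[ℂ] E} (hX : X ∈ skewAdjoint (E →L[ℂ] E)) (hCX : ∀ x, C (X x) = -X (C x))
    (hXV : Commute V X) {x : E} (hx : x ∈ K) : X x ∈ K := by
  have hexp : ∀ t : ℝ, exp (t • X) x ∈ K := by
    intro t
    have ht : t • X ∈ skewAdjoint (E →L[ℂ] E) := skewAdjoint.smul_mem t hX
    have hCt : ∀ y, C ((t • X) y) = -(t • X) (C y) := by
      intro y
      have := C.map_smul' (t : ℂ) (X y)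
      rw [hCX] at this
      simpa using this
    have hCU : ∀ y, C (exp (t • X) y) = star (exp (t • X)) (C y) := by
      intro y
      rw [C.exp_apply _ hCt, star_exp, skewAdjoint.mem_iff.1 ht]
    let _ : NormedAlgebra ℚ (E →L[ℂ] E) := NormedAlgebra.restrictScalars ℚ ℝ _
    have hU := exp_mem_unitary_of_mem_skewAdjoint ht
    have hVU : Commute V (exp (t • X)) := (hXV.smul_right t).exp_right
    have hmem : C.unitaryComp _ hU hCU ∈ commutingConjugations V := by
      intro y
      change exp (t • X) (C (V (exp (t • X) (C y)))) = V y
      rw [← mul_apply_eq_comp V, hVU.eq, mul_apply_eq_comp, hCU,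
        Conjugation.commutes_of_mem hC, C.involutive', ← mul_apply_eq_comp,
        Unitary.mul_star_self_of_mem hU]
      rfl
    have := hinv _ hmem _ (hinv C hC x hx)
    change exp (t • X) (C (C x)) ∈ K at this
    rwa [C.involutive'] at this
  have hd : HasDerivAt (fun t : ℝ => exp (t • X) x) (X x) 0 := by
    have h := (hasDerivAt_exp_smul_const (𝕂 := ℝ) X 0)
    rw [zero_smul, exp_zero, one_mul] at h
    exact ((ContinuousLinearMap.apply ℂ E x).restrictScalars ℝ).hasFDerivAt.comp_hasDerivAt 0 h
  refine hK.mem_of_tendsto hd.tendsto_slope_zero (Eventually.of_forall fun t => ?_)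
  exact K.smul_of_tower_mem _ (K.sub_mem (hexp _) (hexp _))

/-- Every operator `T` in the commutant of `V` with `C T C = T*` leaves invariant each closed
subspace that is invariant under all conjugations commuting with `V`. -/
theorem mem_of_conj_eq_adjoint {V : E →L[ℂ] E} {C : Conjugation E}
    (hC : C ∈ commutingConjugations V) {K : Submodule ℂ E} (hK : IsClosed (K : Set E))
    (hinv : ∀ C ∈ commutingConjugations V, ∀ f ∈ K, C f ∈ K)
    {T : E →L[ℂ] E} (hVT : Commute V T) (hCT : ∀ x, C (T (C x)) = star T x)
    {x : E} (hx : x ∈ K) : T x ∈ K := by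
  have h1 : ∀ y, C (T y) = star T (C y) := fun y => by rw [← hCT, C.involutive']
  have h2 : ∀ y, C (star T y) = T (C y) := fun y => by rw [← hCT, C.involutive']
  have hVT' : Commute V (star T) := by
    ext y
    simp only [mul_apply_eq_comp]
    rw [← hCT, ← hCT, Conjugation.commutes_of_mem hC, ← mul_apply_eq_comp T V,
      ← hVT.eq, mul_apply_eq_comp, Conjugation.commutes_of_mem hC]
  -- `C` commutes with `T + T*`; the factor `i`, which `C` conjugates, makes it both skew-adjoint
  -- and anticommuting with `C`. The difference `T - T*` has both properties already.
  have hs : Complex.I • (T + star T) ∈ skewAdjoint (E →L[ℂ] E) := by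
    rw [skewAdjoint.mem_iff, star_smul, star_add, star_star, add_comm]
    simp [add_comm]
  have hd : T - star T ∈ skewAdjoint (E →L[ℂ] E) := by
    rw [skewAdjoint.mem_iff, star_sub, star_star, neg_sub]
  have m1 := mem_of_skewAdjoint hC hK hinv hs (fun y => by
    simp only [_root_.smul_apply, _root_.add_apply]
    rw [C.map_smul', C.map_add', h1, h2, add_comm]
    simp [add_comm]) ((hVT.add_right hVT').smul_right _) hx
  have m2 := mem_of_skewAdjoint hC hK hinv hd (fun y => by
    simp only [_root_.sub_apply]
    rw [C.map_sub, h1, h2, neg_sub]) (hVT.sub_right hVT') hx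
  have : T x = (2 : ℂ)⁻¹ • ((-Complex.I) • (Complex.I • (T + star T)) x + (T - star T) x) := by
    simp only [_root_.smul_apply, _root_.add_apply,
      _root_.sub_apply, smul_smul]
    simp only [neg_mul, Complex.I_mul_I, neg_neg, one_smul]
    rw [add_add_sub_cancel, ← two_smul ℂ (T x), smul_smul]
    norm_num
  rw [this]
  exact K.smul_mem _ (K.add_mem (K.smul_mem _ m1) m2)

end OperatorLevel

/-! ### Uniqueness of Fourier coefficients for an arbitrary finite measure -/

section Fourier

open scoped Manifold ContDiff

/-- An integrable function on the circle whose Fourier coefficients all vanish is zero a.e. -/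
theorem ae_eq_zero_of_forall_integral_zpow_mul {μ : Measure Circle} [IsFiniteMeasure μ]
    {k : Circle → ℂ} (hk : Integrable k μ)
    (h : ∀ n : ℤ, ∫ ξ, ((ξ ^ n : Circle) : ℂ) * k ξ ∂μ = 0) : ∀ᵐ ξ ∂μ, k ξ = 0 := by
  let e := AddCircle.homeomorphCircle (one_ne_zero : (1 : ℝ) ≠ 0)
  have hint : ∀ φ : C(AddCircle (1 : ℝ), ℂ), Integrable (fun ξ => φ (e.symm ξ) * k ξ) μ := by
    intro φ
    refine hk.bdd_mul (c := ‖φ‖)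
      (φ.continuous.comp e.symm.continuous).measurable.aestronglyMeasurable ?_
    exact ae_of_all _ fun ξ => φ.norm_coe_le_norm _
  let L : C(AddCircle (1 : ℝ), ℂ) →ₗ[ℂ] ℂ :=
    { toFun := fun φ => ∫ ξ, φ (e.symm ξ) * k ξ ∂μ
      map_add' := fun φ ψ => by
        rw [← integral_add (hint φ) (hint ψ)]
        simp [add_mul]
      map_smul' := fun a φ => by
        rw [RingHom.id_apply, smul_eq_mul, ← integral_const_mul]
        simp [mul_assoc] }
  have hL : Continuous L := by
    refine AddMonoidHomClass.continuous_of_bound L (∫ ξ, ‖k ξ‖ ∂μ) fun φ => ?_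
    rw [← integral_mul_const]
    refine (norm_integral_le_of_norm_le (hk.norm.mul_const _) (ae_of_all _ fun ξ => ?_))
    rw [norm_mul, mul_comm]
    gcongr
    exact φ.norm_coe_le_norm _
  have hzero : ∀ φ, L φ = 0 := by
    have hle : Submodule.span ℂ (Set.range (@fourier (1 : ℝ))) ≤ LinearMap.ker L := by
      rw [Submodule.span_le]
      rintro _ ⟨n, rfl⟩
      change ∫ ξ, fourier n (e.symm ξ) * k ξ ∂μ = 0
      convert h n using 5 with ξ
      rw [fourier_apply, AddCircle.toCircle_zsmul]
      congr 2
      rw [← AddCircle.homeomorphCircle_apply (one_ne_zero : (1 : ℝ) ≠ 0)]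
      exact e.apply_symm_apply ξ
    have : Fact ((0 : ℝ) < 1) := ⟨one_pos⟩
    -- `ker L` is closed and contains the monomials, whose span is uniformly dense in the continuous
    -- functions.
    have htop := Submodule.topologicalClosure_minimal _ hle (isClosed_singleton.preimage hL)
    rw [span_fourier_closure_eq_top] at htop
    exact fun φ => htop (Submodule.mem_top : φ ∈ ⊤)
  refine ae_eq_zero_of_integral_contMDiff_smul_eq_zero (𝓡 1) hk.locallyIntegrable
    fun g hg _ => ?_
  have := hzero ⟨fun t => (g (e t) : ℂ), by
    exact Complex.continuous_ofReal.comp (hg.continuous.comp e.continuous)⟩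
  simpa [L] using this

end Fourier

/-! ### The density `h` under reflection -/

section Reflection

theorem circleConj_circleConj (ξ : Circle) : circleConj (circleConj ξ) = ξ := inv_inv ξ

theorem quasiMeasurePreserving_circleConj {μ : Measure Circle} (hμ : conjMeasure μ ≪ μ) :
    Measure.QuasiMeasurePreserving circleConj μ μ := ⟨measurable_circleConj, hμ⟩

theorem measurableEmbedding_circleConj : MeasurableEmbedding circleConj :=
  (MeasurableEquiv.mk ⟨circleConj, circleConj, circleConj_circleConj, circleConj_circleConj⟩
    measurable_circleConj measurable_circleConj).measurableEmbedding

theorem map_circleConj_conjMeasure (μ : Measure Circle) :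
    Measure.map circleConj (conjMeasure μ) = μ := by
  rw [conjMeasure, Measure.map_map measurable_circleConj measurable_circleConj]
  convert Measure.map_id
  exact funext circleConj_circleConj

theorem lintegral_conjMeasure_comp (μ : Measure Circle) (g : Circle → ENNReal) :
    ∫⁻ ξ, g (circleConj ξ) ∂(conjMeasure μ) = ∫⁻ ξ, g ξ ∂μ := by
  rw [← measurableEmbedding_circleConj.lintegral_map g, map_circleConj_conjMeasure]

/-- Integrate over a set `s`: the first factor turns `μ` into `μᶜ`, and reflecting leaves the
integral of `h` over the reflected set, which is `μ(s)`. This cancels the two square roots when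
`J^#` is applied twice. -/
theorem rnDeriv_mul_rnDeriv_circleConj {μ : Measure Circle} [IsFiniteMeasure μ]
    (hμ : conjMeasure μ ≪ μ) :
    ∀ᵐ ξ ∂μ, (conjMeasure μ).rnDeriv μ ξ * (conjMeasure μ).rnDeriv μ (circleConj ξ) = 1 := by
  have hm : Measurable ((conjMeasure μ).rnDeriv μ) := Measure.measurable_rnDeriv _ _
  have hmc := hm.comp measurable_circleConj
  refine ae_eq_of_forall_setLIntegral_eq_of_sigmaFinite (hm.mul hmc) measurable_const
    fun s hs _ => ?_
  have hsc : MeasurableSet (circleConj ⁻¹' s) := measurable_circleConj hs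
  calc ∫⁻ ξ in s, (conjMeasure μ).rnDeriv μ ξ * (conjMeasure μ).rnDeriv μ (circleConj ξ) ∂μ
      = ∫⁻ ξ, (conjMeasure μ).rnDeriv μ ξ *
          s.indicator (fun ξ => (conjMeasure μ).rnDeriv μ (circleConj ξ)) ξ ∂μ := by
        rw [← lintegral_indicator hs]
        congr 1 with ξ
        by_cases h : ξ ∈ s <;> simp [h]
    _ = ∫⁻ ξ, s.indicator (fun ξ => (conjMeasure μ).rnDeriv μ (circleConj ξ)) ξ
          ∂(conjMeasure μ) := lintegral_rnDeriv_mul hμ (hmc.indicator hs).aemeasurable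
    _ = ∫⁻ ξ, (circleConj ⁻¹' s).indicator ((conjMeasure μ).rnDeriv μ) (circleConj ξ)
          ∂(conjMeasure μ) := by
        congr 1 with ξ
        by_cases h : ξ ∈ s <;> simp [h, circleConj_circleConj]
    _ = ∫⁻ ξ in circleConj ⁻¹' s, (conjMeasure μ).rnDeriv μ ξ ∂μ := by
        rw [lintegral_conjMeasure_comp, lintegral_indicator hsc]
    _ = conjMeasure μ (circleConj ⁻¹' s) := Measure.setLIntegral_rnDeriv hμ _
    _ = μ s := by
        rw [← Measure.map_apply measurable_circleConj hs, map_circleConj_conjMeasure]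
    _ = ∫⁻ _ in s, 1 ∂μ := by simp

end Reflection

/-! ### `J^#` as a conjugation and its action on multiplication operators -/

section VectorValued

variable {H : Type*} [NormedAddCommGroup H] [InnerProductSpace ℂ H]

theorem enorm_jSharpFun_sq {μ : Measure Circle} [IsFiniteMeasure μ] (J : Conjugation H)
    (f : Circle → H) : ∀ᵐ ξ ∂μ, ‖jSharpFun μ J f ξ‖ₑ ^ (2 : ENNReal).toReal
      = (conjMeasure μ).rnDeriv μ ξ * ‖f (circleConj ξ)‖ₑ ^ (2 : ENNReal).toReal := by
  filter_upwards [Measure.rnDeriv_lt_top (conjMeasure μ) μ] with ξ hξ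
  have hJ : ‖J (f (circleConj ξ))‖ₑ = ‖f (circleConj ξ)‖ₑ := by
    rw [← ofReal_norm, ← ofReal_norm, J.norm_map']
  rw [jSharpFun, enorm_smul, hJ, ENNReal.mul_rpow_of_nonneg _ _ (by simp)]
  congr 1
  rw [← ofReal_norm, Complex.norm_real, Real.norm_of_nonneg (Real.sqrt_nonneg _)]
  simp only [ENNReal.toReal_ofNat, ENNReal.rpow_ofNat]
  rw [← ENNReal.ofReal_pow (Real.sqrt_nonneg _), Real.sq_sqrt ENNReal.toReal_nonneg,
    ENNReal.ofReal_toReal hξ.ne]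

theorem norm_jSharp {μ : Measure Circle} [IsFiniteMeasure μ] (hμ : conjMeasure μ ≪ μ)
    (J : Conjugation H) (f : Lp H 2 μ) : ‖jSharp hμ J f‖ = ‖f‖ := by
  have hmf : AEMeasurable (fun ξ => ‖f (circleConj ξ)‖ₑ ^ (2 : ENNReal).toReal) μ :=
    (((Lp.aestronglyMeasurable f).comp_quasiMeasurePreserving
      (quasiMeasurePreserving_circleConj hμ)).enorm).pow_const _
  rw [jSharp, Lp.norm_toLp, Lp.norm_def]
  congr 1
  rw [eLpNorm_eq_lintegral_rpow_enorm_toReal (by simp) (by simp),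
    eLpNorm_eq_lintegral_rpow_enorm_toReal (by simp) (by simp),
    lintegral_congr_ae (enorm_jSharpFun_sq J f), lintegral_rnDeriv_mul hμ hmf,
    lintegral_conjMeasure_comp μ (fun ξ => ‖f ξ‖ₑ ^ (2 : ENNReal).toReal)]

/-- Double application of `J^#` with a field of additive maps in between. -/
theorem jSharpFun_comp_jSharp {μ : Measure Circle} [IsFiniteMeasure μ] (hμ : conjMeasure μ ≪ μ)
    (J : Conjugation H) (f : Lp H 2 μ) (F : Circle → H →L[ℂ] H) :
    ∀ᵐ ξ ∂μ, jSharpFun μ J (fun ζ => F ζ (jSharp hμ J f ζ)) ξ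
      = J (F (circleConj ξ) (J (f ξ))) := by
  filter_upwards [(quasiMeasurePreserving_circleConj hμ).ae (jSharp_ae hμ J f),
    rnDeriv_mul_rnDeriv_circleConj hμ] with ξ h1 h2
  rw [jSharpFun, h1, jSharpFun, circleConj_circleConj, map_smul, J.map_smul', Complex.conj_ofReal,
    smul_smul, ← Complex.ofReal_mul, ← Real.sqrt_mul ENNReal.toReal_nonneg, ← ENNReal.toReal_mul,
    h2]
  simp

theorem jSharp_jSharp {μ : Measure Circle} [IsFiniteMeasure μ] (hμ : conjMeasure μ ≪ μ)
    (J : Conjugation H) (f : Lp H 2 μ) : jSharp hμ J (jSharp hμ J f) = f := by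
  refine Lp.ext ?_
  filter_upwards [jSharp_ae hμ J (jSharp hμ J f),
    jSharpFun_comp_jSharp hμ J f (fun _ => ContinuousLinearMap.id ℂ H)] with ξ h1 h2
  simp only [ContinuousLinearMap.id_apply] at h2
  rw [h1, h2, J.involutive']

/-- `J^#` as a conjugation on `L²(μ, H)`. -/
def jSharpConj {μ : Measure Circle} [IsFiniteMeasure μ] (hμ : conjMeasure μ ≪ μ)
    (J : Conjugation H) : Conjugation (Lp H 2 μ) where
  toFun := jSharp hμ J
  map_add' f g := by
    refine Lp.ext ?_
    filter_upwards [jSharp_ae hμ J f, jSharp_ae hμ J g, jSharp_ae hμ J (f + g),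
      (quasiMeasurePreserving_circleConj hμ).ae (Lp.coeFn_add f g),
      Lp.coeFn_add (jSharp hμ J f) (jSharp hμ J g)] with ξ h1 h2 h3 h4 h5
    rw [h3, h5, Pi.add_apply, h1, h2, jSharpFun, h4, Pi.add_apply, J.map_add', smul_add]
    rfl
  map_smul' a f := by
    refine Lp.ext ?_
    filter_upwards [jSharp_ae hμ J f, jSharp_ae hμ J (a • f),
      (quasiMeasurePreserving_circleConj hμ).ae (Lp.coeFn_smul a f),
      Lp.coeFn_smul (starRingEnd ℂ a) (jSharp hμ J f)] with ξ h1 h2 h3 h4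
    rw [h2, h4, Pi.smul_apply, h1, jSharpFun, h3, Pi.smul_apply, J.map_smul', jSharpFun,
      smul_comm]
  norm_map' := norm_jSharp hμ J
  involutive' := jSharp_jSharp hμ J

theorem bilateralShift_ae {μ : Measure Circle} (f : Lp H 2 μ) :
    ∀ᵐ ξ ∂μ, bilateralShift H μ f ξ = (ξ : ℂ) • f ξ :=
  mulOp_ae (memLinfty_coord H μ) f

/-- Reflection replaces the factor `ξ` by `ξ̄`, and the antilinear `J` conjugates it back. -/
theorem jSharpConj_mem {μ : Measure Circle} [IsFiniteMeasure μ] (hμ : conjMeasure μ ≪ μ)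
    (J : Conjugation H) : jSharpConj hμ J ∈ commutingConjugations (bilateralShift H μ) := by
  intro f
  refine Lp.ext ?_
  filter_upwards [jSharp_ae hμ J (bilateralShift H μ (jSharp hμ J f)),
    (quasiMeasurePreserving_circleConj hμ).ae (bilateralShift_ae (jSharp hμ J f)),
    jSharpFun_comp_jSharp hμ J f (fun ξ => (ξ : ℂ) • ContinuousLinearMap.id ℂ H),
    bilateralShift_ae f] with ξ h1 h2 h3 h4
  change jSharp hμ J (bilateralShift H μ (jSharp hμ J f)) ξ = _
  rw [h1, jSharpFun, h2, h4]
  simp only [jSharpFun] at h3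
  refine h3.trans ?_
  change J ((circleConj ξ : ℂ) • J (f ξ)) = _
  rw [J.map_smul', J.involutive', coe_circleConj, Complex.conj_conj]

theorem commute_bilateralShift_mulOp {μ : Measure Circle} {F : Circle → H →L[ℂ] H}
    (hF : MemLinfty F μ) : Commute (bilateralShift H μ) (mulOp hF) := by
  ext1 f
  refine Lp.ext ?_
  change bilateralShift H μ (mulOp hF f) =ᵐ[μ] mulOp hF (bilateralShift H μ f)
  filter_upwards [bilateralShift_ae (mulOp hF f), bilateralShift_ae f, mulOp_ae hF f,
    mulOp_ae hF (bilateralShift H μ f)] with ξ h1 h2 h3 h4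
  rw [h1, h4, h2, h3, map_smul]

/-- The a.e. value of `J^# M_F J^#`. -/
theorem jSharp_mulOp_jSharp_ae {μ : Measure Circle} [IsFiniteMeasure μ] (hμ : conjMeasure μ ≪ μ)
    (J : Conjugation H) {F : Circle → H →L[ℂ] H} (hF : MemLinfty F μ) (f : Lp H 2 μ) :
    ∀ᵐ ξ ∂μ, jSharp hμ J (mulOp hF (jSharp hμ J f)) ξ = J (F (circleConj ξ) (J (f ξ))) := by
  filter_upwards [jSharp_ae hμ J (mulOp hF (jSharp hμ J f)),
    (quasiMeasurePreserving_circleConj hμ).ae (mulOp_ae hF (jSharp hμ J f)),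
    jSharpFun_comp_jSharp hμ J f F] with ξ h1 h2 h3
  rw [h1, ← h3, jSharpFun, h2, jSharpFun]

/-- The left side multiplies by `J F(ξ̄) J`; the hypothesis read at `ξ̄` makes this `F(ξ)*`, the two
reflections cancelling. -/
theorem jSharp_mulOp_jSharp [CompleteSpace H] {μ : Measure Circle} [IsFiniteMeasure μ]
    (hμ : conjMeasure μ ≪ μ) (J : Conjugation H) {F : Circle → H →L[ℂ] H} (hF : MemLinfty F μ)
    (hJF : ∀ᵐ ξ ∂μ, ∀ x, J (F ξ (J x)) = sharp F ξ x) (f : Lp H 2 μ) :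
    jSharp hμ J (mulOp hF (jSharp hμ J f)) = star (mulOp hF) f := by
  refine ext_inner_right ℂ fun g => ?_
  rw [ContinuousLinearMap.star_eq_adjoint, ContinuousLinearMap.adjoint_inner_left,
    L2.inner_def, L2.inner_def]
  refine integral_congr_ae ?_
  filter_upwards [jSharp_mulOp_jSharp_ae hμ J hF f, mulOp_ae hF g,
    (quasiMeasurePreserving_circleConj hμ).ae hJF] with ξ h1 h2 h3
  rw [h1, h2, h3, sharp, circleConj_circleConj, ContinuousLinearMap.adjoint_inner_left]

end VectorValued

/-! ### Isometries commuting with the shift are multiplications -/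

section Commutant

variable {H : Type*} [NormedAddCommGroup H] [InnerProductSpace ℂ H]

theorem memLinfty_coord_inv (H : Type*) [NormedAddCommGroup H] [InnerProductSpace ℂ H]
    (μ : Measure Circle) :
    MemLinfty (fun ξ => ((ξ⁻¹ : Circle) : ℂ) • ContinuousLinearMap.id ℂ H) μ where
  aestronglyMeasurable x := by
    have h : Continuous (fun ξ : Circle => ((ξ⁻¹ : Circle) : ℂ)) :=
      continuous_subtype_val.comp continuous_inv
    exact (h.measurable.stronglyMeasurable.smul_const x).aestronglyMeasurable
  ess_bounded := ⟨1, ae_of_all _ fun ξ => by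
    rw [norm_smul, Circle.norm_coe, one_mul]
    exact ContinuousLinearMap.norm_id_le⟩

theorem mulOp_coord_inv_ae {μ : Measure Circle} (f : Lp H 2 μ) :
    ∀ᵐ ξ ∂μ, mulOp (memLinfty_coord_inv H μ) f ξ = ((ξ⁻¹ : Circle) : ℂ) • f ξ :=
  mulOp_ae (memLinfty_coord_inv H μ) f

/-- The bilateral shift as an invertible operator. -/
def shiftUnit (H : Type*) [NormedAddCommGroup H] [InnerProductSpace ℂ H]
    (μ : Measure Circle) : (Lp H 2 μ →L[ℂ] Lp H 2 μ)ˣ where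
  val := bilateralShift H μ
  inv := mulOp (memLinfty_coord_inv H μ)
  val_inv := by
    ext1 f
    refine Lp.ext ?_
    filter_upwards [bilateralShift_ae (mulOp (memLinfty_coord_inv H μ) f),
      mulOp_coord_inv_ae f] with ξ h1 h2
    refine h1.trans ?_
    rw [h2, smul_smul, ← Circle.coe_mul, mul_inv_cancel, Circle.coe_one, one_smul]
    rfl
  inv_val := by
    ext1 f
    refine Lp.ext ?_
    filter_upwards [mulOp_coord_inv_ae (bilateralShift H μ f), bilateralShift_ae f] with ξ h1 h2
    refine h1.trans ?_
    rw [h2, smul_smul, ← Circle.coe_mul, inv_mul_cancel, Circle.coe_one, one_smul]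
    rfl

theorem shiftUnit_zpow_ae {μ : Measure Circle} (n : ℤ) (f : Lp H 2 μ) :
    ∀ᵐ ξ ∂μ, ((shiftUnit H μ ^ n : (Lp H 2 μ →L[ℂ] Lp H 2 μ)ˣ) : Lp H 2 μ →L[ℂ] Lp H 2 μ) f ξ
      = ((ξ ^ n : Circle) : ℂ) • f ξ := by
  induction n generalizing f with
  | zero => exact ae_of_all _ fun ξ => by simp
  | succ n ih =>
    filter_upwards [ih (bilateralShift H μ f), bilateralShift_ae f] with ξ h1 h2
    rw [zpow_add_one, zpow_add_one, Circle.coe_mul, mul_smul, ← h2, ← h1]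
    rfl
  | pred n ih =>
    filter_upwards [ih (mulOp (memLinfty_coord_inv H μ) f), mulOp_coord_inv_ae f] with ξ h1 h2
    rw [zpow_sub_one, zpow_sub_one, Circle.coe_mul, mul_smul, ← h2, ← h1]
    rfl

/-- An isometry commuting with the bilateral shift preserves norms pointwise a.e. -/
theorem norm_ae_eq_of_commute {μ : Measure Circle} [IsFiniteMeasure μ]
    (W : Lp H 2 μ →ₗᵢ[ℂ] Lp H 2 μ)
    (hW : Commute (bilateralShift H μ) W.toContinuousLinearMap) (f : Lp H 2 μ) :
    ∀ᵐ ξ ∂μ, ‖W f ξ‖ = ‖f ξ‖ := by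
  -- The Fourier coefficients of `‖g(ξ)‖²` are the numbers `⟨g, Vⁿ g⟩`, which `W` preserves.
  have hcoef : ∀ (g : Lp H 2 μ) (n : ℤ),
      ∫ ξ, ((ξ ^ n : Circle) : ℂ) * inner ℂ (g ξ) (g ξ) ∂μ
        = inner ℂ g (((shiftUnit H μ ^ n : (Lp H 2 μ →L[ℂ] Lp H 2 μ)ˣ) :
            Lp H 2 μ →L[ℂ] Lp H 2 μ) g) := by
    intro g n
    rw [L2.inner_def]
    refine integral_congr_ae ?_
    filter_upwards [shiftUnit_zpow_ae n g] with ξ h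
    rw [h, inner_smul_right]
  have hint : ∀ (g : Lp H 2 μ) (n : ℤ),
      Integrable (fun ξ => ((ξ ^ n : Circle) : ℂ) * inner ℂ (g ξ) (g ξ)) μ := by
    intro g n
    refine (L2.integrable_inner (𝕜 := ℂ) g g).bdd_mul (c := 1) ?_
      (ae_of_all _ fun ξ => (Circle.norm_coe _).le)
    have h : Continuous (fun ξ : Circle => ((ξ ^ n : Circle) : ℂ)) :=
      continuous_subtype_val.comp (continuous_zpow n)
    exact h.measurable.aestronglyMeasurable
  have hz := ae_eq_zero_of_forall_integral_zpow_mul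
    ((L2.integrable_inner (𝕜 := ℂ) (W f) (W f)).sub (L2.integrable_inner (𝕜 := ℂ) f f))
    (fun n => by
      have hc : Commute ((shiftUnit H μ ^ n : (Lp H 2 μ →L[ℂ] Lp H 2 μ)ˣ) :
          Lp H 2 μ →L[ℂ] Lp H 2 μ) W.toContinuousLinearMap :=
        Commute.units_zpow_left (u := shiftUnit H μ) hW n
      have hcf := congrArg (fun A : Lp H 2 μ →L[ℂ] Lp H 2 μ => A f) hc.eq
      change _ = W _ at hcf
      simp only [Pi.sub_apply, mul_sub]
      rw [integral_sub (hint _ n) (hint _ n), hcoef, hcoef, sub_eq_zero,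
        ← W.inner_map_map f]
      exact congrArg (inner ℂ (W f)) hcf)
  filter_upwards [hz] with ξ h
  rw [Pi.sub_apply, sub_eq_zero, inner_self_eq_norm_sq_to_K, inner_self_eq_norm_sq_to_K] at h
  have h' : ‖W f ξ‖ ^ 2 = ‖f ξ‖ ^ 2 := by exact_mod_cast h
  exact (sq_eq_sq₀ (norm_nonneg _) (norm_nonneg _)).1 h'

/-- A map on a dense sequence that respects norms of certain linear combinations extends to a
linear isometry. -/
theorem exists_linearIsometry_of_dense [CompleteSpace H] {d u : ℕ → H} {c : ℕ → ℂ}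
    (hd : DenseRange d) (hc : DenseRange c)
    (h : ∀ j m n k, ‖c j • u m + u n - u k‖ = ‖c j • d m + d n - d k‖) :
    ∃ A : H →ₗᵢ[ℂ] H, ∀ n, A (d n) = u n := by
  have h1 : ∀ (a : ℂ) m n k, ‖a • u m + u n - u k‖ = ‖a • d m + d n - d k‖ := fun a m n k =>
    hc.induction_on (p := fun a => ‖a • u m + u n - u k‖ = ‖a • d m + d n - d k‖) a
      (isClosed_eq (by fun_prop) (by fun_prop)) fun j => h j m n k
  have hiso : ∀ n k, ‖u n - u k‖ = ‖d n - d k‖ := fun n k => by simpa using h1 0 n n k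
  -- `d` may repeat values; by `hiso` the choice of index does not matter.
  let φ : Set.range d → H := fun y => u y.2.choose
  have hφ : Isometry φ := Isometry.of_dist_eq fun y z => by
    rw [dist_eq_norm, hiso, y.2.choose_spec, z.2.choose_spec, ← dist_eq_norm]
    rfl
  have hdense : DenseRange (Subtype.val : Set.range d → H) := by
    rw [DenseRange, Subtype.range_coe]
    exact hd
  have hind : IsUniformInducing (Subtype.val : Set.range d → H) := isUniformInducing_val _
  let g : H → H := (hind.isDenseInducing hdense).extend φ
  have hgc : Continuous g :=
    (uniformContinuous_uniformly_extend hind hdense hφ.uniformContinuous).continuous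
  have hgd : ∀ n, g (d n) = u n := fun n => by
    have h2 : g (d n) = φ ⟨d n, n, rfl⟩ :=
      uniformly_extend_of_ind hind hdense hφ.uniformContinuous ⟨d n, n, rfl⟩
    rw [h2, ← sub_eq_zero, ← norm_eq_zero, hiso, norm_eq_zero, sub_eq_zero]
    exact (⟨d n, n, rfl⟩ : Set.range d).2.choose_spec
  have h2 : ∀ (a : ℂ) x y z, ‖a • g x + g y - g z‖ = ‖a • x + y - z‖ := by
    intro a x y z
    refine hd.induction_on (p := fun x => ‖a • g x + g y - g z‖ = ‖a • x + y - z‖) x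
      (isClosed_eq (by fun_prop) (by fun_prop)) fun m => ?_
    refine hd.induction_on (p := fun y => ‖a • g (d m) + g y - g z‖ = ‖a • d m + y - z‖) y
      (isClosed_eq (by fun_prop) (by fun_prop)) fun n => ?_
    refine hd.induction_on
      (p := fun z => ‖a • g (d m) + g (d n) - g z‖ = ‖a • d m + d n - z‖) z
      (isClosed_eq (by fun_prop) (by fun_prop)) fun k => ?_
    rw [hgd, hgd, hgd]
    exact h1 a m n k
  have h3 : ∀ (a : ℂ) x y, g (a • x + y) = a • g x + g y := fun a x y => by
    -- With `z = a • x + y` the norm vanishes, so linearity comes for free.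
    have := h2 a x y (a • x + y)
    rw [sub_self, norm_zero, norm_eq_zero, sub_eq_zero] at this
    exact this.symm
  have h0 : g 0 = 0 := by simpa using h2 (-1) 0 0 0
  refine ⟨⟨⟨⟨g, fun x y => by simpa using h3 1 x y⟩, fun a x => ?_⟩, fun x => ?_⟩, hgd⟩
  · simpa [h0] using h3 a x 0
  · simpa [h0] using h2 0 0 x 0

/-- Isometries commuting with the bilateral shift are multiplications by a measurable field of
isometries. -/
theorem exists_mulOp_eq_of_commute [CompleteSpace H] [TopologicalSpace.SeparableSpace H]
    {μ : Measure Circle} [IsFiniteMeasure μ] (W : Lp H 2 μ →ₗᵢ[ℂ] Lp H 2 μ)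
    (hW : Commute (bilateralShift H μ) W.toContinuousLinearMap) :
    ∃ (F : Circle → H →L[ℂ] H) (hF : MemLinfty F μ),
      (∀ᵐ ξ ∂μ, ∀ x, ‖F ξ x‖ = ‖x‖) ∧ ∀ f, mulOp hF f = W f := by
  let d := TopologicalSpace.denseSeq H
  let c := TopologicalSpace.denseSeq ℂ
  have hd : DenseRange d := TopologicalSpace.denseRange_denseSeq H
  let t : H → Lp H 2 μ := fun x => W (Lp.const 2 μ x)
  have hdiff : ∀ (f : Lp H 2 μ) (x : H), ∀ᵐ ξ ∂μ, ‖W f ξ - t x ξ‖ = ‖f ξ - x‖ := by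
    intro f x
    filter_upwards [norm_ae_eq_of_commute W hW (f - Lp.const 2 μ x),
      Lp.coeFn_sub f (Lp.const 2 μ x), Lp.coeFn_const (p := 2) (μ := μ) x,
      Lp.coeFn_sub (W f) (t x)] with ξ h1 h2 h3 h4
    rw [map_sub, h4, h2, Pi.sub_apply, Pi.sub_apply, h3] at h1
    exact h1
  -- Scalars and vectors range over countable dense sets, so one null set serves all these
  -- identities.
  have hcomb : ∀ᵐ ξ ∂μ, ∀ j m n k, ‖c j • t (d m) ξ + t (d n) ξ - t (d k) ξ‖
      = ‖c j • d m + d n - d k‖ := by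
    simp only [ae_all_iff]
    intro j m n k
    filter_upwards [hdiff (c j • Lp.const 2 μ (d m) + Lp.const 2 μ (d n)) (d k),
      Lp.coeFn_add (c j • Lp.const 2 μ (d m)) (Lp.const 2 μ (d n)),
      Lp.coeFn_smul (c j) (Lp.const 2 μ (d m)), Lp.coeFn_const (p := 2) (μ := μ) (d m),
      Lp.coeFn_const (p := 2) (μ := μ) (d n), Lp.coeFn_add (c j • t (d m)) (t (d n)),
      Lp.coeFn_smul (c j) (t (d m))] with ξ h1 h2 h3 h4 h5 h6 h7
    rw [map_add, map_smul, h6, h2, Pi.add_apply, Pi.add_apply, h7, h3, Pi.smul_apply,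
      Pi.smul_apply, h4, h5] at h1
    exact h1
  classical
  let F : Circle → H →L[ℂ] H := fun ξ =>
    if h : ∃ A : H →ₗᵢ[ℂ] H, ∀ n, A (d n) = t (d n) ξ then
      h.choose.toContinuousLinearMap else 0
  have hF1 : ∀ᵐ ξ ∂μ, (∀ x, ‖F ξ x‖ = ‖x‖) ∧ ∀ n, F ξ (d n) = t (d n) ξ := by
    filter_upwards [hcomb] with ξ h
    have hex := exists_linearIsometry_of_dense hd (TopologicalSpace.denseRange_denseSeq ℂ) h
    have hFξ : F ξ = hex.choose.toContinuousLinearMap := dif_pos hex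
    rw [hFξ]
    exact ⟨hex.choose.norm_map, hex.choose_spec⟩
  -- The point `W f ξ` is as far from `F ξ y` as `f ξ` is from `y`, first for `y` in the dense
  -- sequence, then for every `y`; take `y = f ξ`.
  have hF2 : ∀ f : Lp H 2 μ, ∀ᵐ ξ ∂μ, W f ξ = F ξ (f ξ) := by
    intro f
    filter_upwards [hF1, ae_all_iff.2 fun n => hdiff f (d n)] with ξ h1 h2
    have h3 : ∀ y, ‖W f ξ - F ξ y‖ = ‖f ξ - y‖ := fun y =>
      hd.induction_on (p := fun y => ‖W f ξ - F ξ y‖ = ‖f ξ - y‖) y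
        (isClosed_eq (by fun_prop) (by fun_prop)) fun n => by rw [h1.2, h2]
    have := h3 (f ξ)
    rwa [sub_self, norm_zero, norm_eq_zero, sub_eq_zero] at this
  have hF : MemLinfty F μ :=
    { aestronglyMeasurable := fun x => by
        refine (Lp.aestronglyMeasurable (t x)).congr ?_
        filter_upwards [hF2 (Lp.const 2 μ x), Lp.coeFn_const (p := 2) (μ := μ) x] with ξ h1 h2
        rw [h1, h2, Function.const_apply]
      ess_bounded := ⟨1, by
        filter_upwards [hF1] with ξ h
        exact ContinuousLinearMap.opNorm_le_bound _ zero_le_one fun x => by rw [h.1, one_mul]⟩ }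
  refine ⟨F, hF, hF1.mono fun ξ h => h.1, fun f => Lp.ext ?_⟩
  filter_upwards [mulOp_ae hF f, hF2 f] with ξ h1 h2
  rw [h1, h2]

/-- Every conjugation commuting with the bilateral shift is of the form `M_F J^#` with
`J F J = F^#`. -/
theorem exists_mulOp_jSharp_eq [CompleteSpace H] [TopologicalSpace.SeparableSpace H]
    {μ : Measure Circle} [IsFiniteMeasure μ] (hμ : conjMeasure μ ≪ μ) (J : Conjugation H)
    {C : Conjugation (Lp H 2 μ)} (hC : C ∈ commutingConjugations (bilateralShift H μ)) :
    ∃ (F : Circle → H →L[ℂ] H) (hF : MemLinfty F μ),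
      (∀ᵐ ξ ∂μ, ∀ x, J (F ξ (J x)) = sharp F ξ x) ∧
        ∀ f, C f = mulOp hF (jSharp hμ J f) := by
  let S := jSharpConj hμ J
  have hS : S ∈ commutingConjugations (bilateralShift H μ) := jSharpConj_mem hμ J
  let W : Lp H 2 μ →ₗᵢ[ℂ] Lp H 2 μ :=
    { toFun := fun f => C (S f)
      map_add' := fun f g => by rw [S.map_add', C.map_add']
      map_smul' := fun a f => by
        rw [S.map_smul', C.map_smul', Complex.conj_conj, RingHom.id_apply]
      norm_map' := fun f => by
        change ‖C (S f)‖ = ‖f‖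
        rw [C.norm_map', S.norm_map'] }
  have hW : Commute (bilateralShift H μ) W.toContinuousLinearMap := by
    ext1 f
    change bilateralShift H μ (C (S f)) = C (S (bilateralShift H μ f))
    rw [Conjugation.commutes_of_mem hS, Conjugation.commutes_of_mem hC]
  obtain ⟨F, hF, hiso, hFW⟩ := exists_mulOp_eq_of_commute W hW
  have hCF : ∀ f, C f = mulOp hF (jSharp hμ J f) := fun f => by
    rw [hFW]
    change C f = C (S (S f))
    rw [S.involutive']
  refine ⟨F, hF, ?_, hCF⟩
  have hd := TopologicalSpace.denseRange_denseSeq H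
  -- This is `C² = 1` tested on constant functions.
  have hinv : ∀ᵐ ξ ∂μ, ∀ n, F ξ (J (F (circleConj ξ) (J (TopologicalSpace.denseSeq H n))))
      = TopologicalSpace.denseSeq H n := by
    refine ae_all_iff.2 fun n => ?_
    let f := Lp.const 2 μ (TopologicalSpace.denseSeq H n)
    have hf : mulOp hF (jSharp hμ J (mulOp hF (jSharp hμ J f))) = f := by
      rw [← hCF, ← hCF, C.involutive']
    filter_upwards [mulOp_ae hF (jSharp hμ J (mulOp hF (jSharp hμ J f))),
      jSharp_mulOp_jSharp_ae hμ J hF f,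
      Lp.coeFn_const (p := 2) (μ := μ) (TopologicalSpace.denseSeq H n)] with ξ h1 h2 h3
    rw [hf, h2, h3, Function.const_apply] at h1
    exact h1.symm
  -- `J F(ξ̄) J` is a right inverse of the isometry `F(ξ)`, whose adjoint is a left inverse, so the
  -- two agree.
  have hadj : ∀ᵐ ξ ∂μ, ∀ x, J (F (circleConj ξ) (J x))
      = ContinuousLinearMap.adjoint (F ξ) x := by
    filter_upwards [hinv, hiso] with ξ h1 h2 x
    have hJ := J.continuous
    have h3 : F ξ (J (F (circleConj ξ) (J x))) = x :=
      hd.induction_on (p := fun x => F ξ (J (F (circleConj ξ) (J x))) = x) x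
        (isClosed_eq (by fun_prop) continuous_id) h1
    have h4 := (ContinuousLinearMap.norm_map_iff_adjoint_comp_self (F ξ)).1 h2
    have h5 := congrArg (fun A : H →L[ℂ] H => A (J (F (circleConj ξ) (J x)))) h4
    simp only [ContinuousLinearMap.comp_apply, h3] at h5
    exact h5.symm
  filter_upwards [(quasiMeasurePreserving_circleConj hμ).ae hadj] with ξ h x
  rw [circleConj_circleConj] at h
  exact h x

end Commutant

end

theorem mainTheorem7 {H : Type*} [NormedAddCommGroup H] [InnerProductSpace ℂ H]
    [CompleteSpace H] [TopologicalSpace.SeparableSpace H]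
    (μ : Measure Circle) [IsFiniteMeasure μ] (hμ : conjMeasure μ ≪ μ)
    (J : Conjugation H)
    (K : Submodule ℂ (Lp H 2 μ)) (hK : IsClosed (K : Set (Lp H 2 μ))) :
    (∀ C ∈ commutingConjugations (bilateralShift H μ), ∀ f ∈ K, C f ∈ K) ↔
      ((∀ f ∈ K, jSharp hμ J f ∈ K) ∧
        ∀ (F : Circle → H →L[ℂ] H) (hF : MemLinfty F μ),
          (∀ᵐ ξ ∂μ, ∀ x, J (F ξ (J x)) = sharp F ξ x) →
            ∀ f ∈ K, mulOp hF f ∈ K) := by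
  constructor
  · intro h
    refine ⟨h _ (jSharpConj_mem hμ J), fun F hF hJF f hf => ?_⟩
    exact mem_of_conj_eq_adjoint (jSharpConj_mem hμ J) hK h (commute_bilateralShift_mulOp hF)
      (jSharp_mulOp_jSharp hμ J hF hJF) hf
  · rintro ⟨hJ, hM⟩ C hC f hf
    obtain ⟨F, hF, hJF, hCF⟩ := exists_mulOp_jSharp_eq hμ J hC
    rw [hCF]
    exact hM F hF hJF _ (hJ f hf)
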